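/- Let $k$ be an infinite field, $P=k[x_1,\dots,x_n]$ with the degree reverse lexicographic order satisfying $x_1\succ x_2\succ\cdots\succ x_n$, and let $I$ be a homogeneous ideal of $P$. For an ideal $J$ of $P$ let $\mathrm{lt}(J)$ be the monomial ideal generated by the leading terms of the nonzero elements of $J$. A matrix $A=(a_{ij})\in\mathrm{GL}(n,k)$ acts on $P$ by $x_i\mapsto\sum_j a_{ij}x_j$, and $A\cdot I$ denotes the image of $I$. The generic initial ideal $\mathrm{gin}(I)$ is the ideal $J$ for which there is a nonempty Zariski open subset $U\subseteq\mathrm{GL}(n,k)$ with $\mathrm{lt}(A\cdot I)=J$ for all $A\in U$; $I$ is in GIN position if $\mathrm{lt}(I)=\mathrm{gin}(I)$. For a term $t\neq 1$ let $m(t)$ be the largest index $i$ with $x_i\mid t$, and put $m(1)=1$. For an ideal $J$ of $P$ and $q\ge 0$ the $\beta$-vector of $J$ in degree $q$ is $\beta_q(J)=(\beta_q^{(1)}(J),\dots,\beta_q^{(n)}(J))\in\mathbb{N}_0^n$, where $\beta_q^{(i)}(J)$ is the number of terms $t\in\mathrm{lt}(J)$ of degree $q$ with $m(t)=i$. The ideal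 $I$ is in $\beta$-maximal position if $\beta_q(I)\succeq_{\mathrm{lex}}\beta_q(A\cdot I)$ for all $A\in\mathrm{GL}(n,k)$ and all $q\ge 0$ with $I_q\neq 0$, where $I_q$ is the degree $q$ component of $I$ and the first entry is the most significant one for $\succeq_{\mathrm{lex}}$. Then $\mathrm{gin}(I)$ is well defined (exactly one ideal $J$ as above exists), and: 1. If $I$ is in GIN position, then $I$ is in $\beta$-maximal position. 2. If $I$ is in $\beta$-maximal position, then $\beta_q(\mathrm{gin}(I))=\beta_q(I)$ for every degree $q\ge 0$ with $I_q\neq 0$. -/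

import Mathlib

attribute [local instance] MvPolynomial.gradedAlgebra

noncomputable section

namespace GenericPosition

open MvPolynomial

/-- `DegRevLexLT μ ν`: the term `x^μ` is smaller than the term `x^ν` in the degree reverse
lexicographic order with `x₁ ≻ x₂ ≻ ⋯ ≻ xₙ` (the variable `xᵢ₊₁` is `X i`, `i : Fin n`):
either the total degree is smaller, or the total degrees agree and at the last index at which
the exponents differ the exponent in `μ` is the larger one. -/
def DegRevLexLT {n : ℕ} (μ ν : Fin n →₀ ℕ) : Prop :=
  μ.degree < ν.degree ∨
    (μ.degree = ν.degree ∧ ∃ i : Fin n, ν i < μ i ∧ ∀ j : Fin n, i < j → μ j = ν j)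

/-- `x^μ` is the leading term of `f` (this forces `f ≠ 0`). -/
def IsLeadingExponent {n : ℕ} {k : Type*} [Field k]
    (f : MvPolynomial (Fin n) k) (μ : Fin n →₀ ℕ) : Prop :=
  μ ∈ f.support ∧ ∀ ν ∈ f.support, ν ≠ μ → DegRevLexLT ν μ

/-- The leading ideal `lt(I)`, generated by the leading terms of all nonzero elements of `I`. -/
def leadingIdeal {n : ℕ} {k : Type*} [Field k]
    (I : Ideal (MvPolynomial (Fin n) k)) : Ideal (MvPolynomial (Fin n) k) :=
  Ideal.span {t | ∃ f ∈ I, ∃ μ, IsLeadingExponent f μ ∧ t = monomial μ (1 : k)}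

/-- The linear change of coordinates `xᵢ ↦ ∑ⱼ aᵢⱼ xⱼ`. -/
def coordChange {n : ℕ} {k : Type*} [Field k] (A : GL (Fin n) k) :
    MvPolynomial (Fin n) k →ₐ[k] MvPolynomial (Fin n) k :=
  aeval fun i => ∑ j, C ((A : Matrix (Fin n) (Fin n) k) i j) * X j

/-- The transformed ideal `A · I`. (As `A` is invertible, `coordChange A` is an automorphism, so
the ideal generated by the image of `I` is the image of `I`.) -/
def transform {n : ℕ} {k : Type*} [Field k] (A : GL (Fin n) k)
    (I : Ideal (MvPolynomial (Fin n) k)) : Ideal (MvPolynomial (Fin n) k) :=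
  I.map (coordChange A)

/-- Zariski open subsets of `GL(n, k)`: the complement of `U` is the set of common zeros in
`GL(n, k)` of a set `S` of polynomials in the `n²` matrix entries. -/
def IsZariskiOpen {n : ℕ} {k : Type*} [Field k] (U : Set (GL (Fin n) k)) : Prop :=
  ∃ S : Set (MvPolynomial (Fin n × Fin n) k),
    U = {A : GL (Fin n) k | ∃ p ∈ S, eval (fun ij => (A : Matrix (Fin n) (Fin n) k) ij.1 ij.2) p ≠ 0}

/-- `J` is the common leading ideal of the ideals `A · I` for all `A` in some nonempty Zariski
open subset of `GL(n, k)`. -/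
def IsGenericInitialIdeal {n : ℕ} {k : Type*} [Field k]
    (I J : Ideal (MvPolynomial (Fin n) k)) : Prop :=
  ∃ U : Set (GL (Fin n) k), IsZariskiOpen U ∧ U.Nonempty ∧
    ∀ A ∈ U, leadingIdeal (transform A I) = J

open Classical in
/-- The generic initial ideal `gin(I)` (over an infinite field there is exactly one ideal `J`
with `IsGenericInitialIdeal I J`). -/
def gin {n : ℕ} {k : Type*} [Field k]
    (I : Ideal (MvPolynomial (Fin n) k)) : Ideal (MvPolynomial (Fin n) k) :=
  if h : ∃ J, IsGenericInitialIdeal I J then h.choose else ⊥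

/-- GIN position: `lt(I) = gin(I)`. -/
def InGINPosition {n : ℕ} {k : Type*} [Field k]
    (I : Ideal (MvPolynomial (Fin n) k)) : Prop :=
  leadingIdeal I = gin I

/-- The index `m(x^μ)`: the largest `i ∈ {1, …, n}` such that `xᵢ` divides `x^μ`, and `1` for the
term `1`. -/
def maxIndex {n : ℕ} (μ : Fin n →₀ ℕ) : ℕ :=
  if μ = 0 then 1 else μ.support.sup fun i => (i : ℕ) + 1

/-- The `β`-vector of `I` in degree `q`: its `i`-th entry, `i = 1, …, n`, is the number of terms
`t ∈ lt(I)` of degree `q` with `m(t) = i`. -/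
def betaVector {n : ℕ} {k : Type*} [Field k]
    (I : Ideal (MvPolynomial (Fin n) k)) (q : ℕ) : Fin n → ℕ := fun i =>
  Set.ncard {μ : Fin n →₀ ℕ |
    μ.degree = q ∧ monomial μ (1 : k) ∈ leadingIdeal I ∧ maxIndex μ = (i : ℕ) + 1}

/-- The degree `q` component `I_q = I ∩ P_q`. -/
def degreePart {n : ℕ} {k : Type*} [Field k]
    (I : Ideal (MvPolynomial (Fin n) k)) (q : ℕ) : Submodule k (MvPolynomial (Fin n) k) :=
  I.restrictScalars k ⊓ homogeneousSubmodule (Fin n) k q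

/-- `β`-maximal position: `β_q(A · I) ≤ β_q(I)` lexicographically (the first entry being the most
significant one) for all `A ∈ GL(n, k)` and all `q` with `I_q ≠ 0`. -/
def InBetaMaximalPosition {n : ℕ} {k : Type*} [Field k]
    (I : Ideal (MvPolynomial (Fin n) k)) : Prop :=
  ∀ (A : GL (Fin n) k) (q : ℕ), degreePart I q ≠ ⊥ →
    toLex (betaVector (transform A I) q) ≤ toLex (betaVector I q)

end GenericPosition

end

namespace GenericPosition

open MvPolynomial

variable {n : ℕ} {k : Type*} [Field k]

/-! ### The degree reverse lexicographic order is a translation-invariant strict total order. -/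

section DegRevLex

/-! Fix a degree `q` and a set `T` of exponents of degree `q` closed upwards in the term order. The
number of leading exponents of `A · I` in `T` is the rank of the projection of `(A · I)_q` to the
coordinates in `T`. A rank can only drop on the zero set of a minor, so this number is lower
semicontinuous in `A` (`card_leadingIn_semicontinuous`) and takes its maximum on a nonempty open
set. There are finitely many `T` in each degree, and their counts determine the leading exponents of
that degree (`leadingExponents_eq_of_card`); Dickson's lemma reduces the infinitely many degrees to
finitely many (`exists_generic`). Hence `gin I` exists and maximizes every count.

In this order the terms of degree `q` with `m(t) ≤ i` form such a set `T`, and their count is a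
partial sum of the `β`-vector. Maximal partial sums are lexicographically maximal
(`betaVector_transform_le_gin`), and both claims follow because `gin I` is itself some `lt(A · I)`.
-/

theorem DegRevLexLT.irrefl (μ : Fin n →₀ ℕ) : ¬ DegRevLexLT μ μ := by
  rintro (h | ⟨_, i, h, _⟩) <;> exact lt_irrefl _ h

theorem DegRevLexLT.trans {μ ν ρ : Fin n →₀ ℕ} (h₁ : DegRevLexLT μ ν) (h₂ : DegRevLexLT ν ρ) :
    DegRevLexLT μ ρ := by
  rcases h₁ with h₁ | ⟨d₁, i, hi, hi'⟩ <;> rcases h₂ with h₂ | ⟨d₂, j, hj, hj'⟩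
  · exact Or.inl (h₁.trans h₂)
  · exact Or.inl (d₂ ▸ h₁)
  · exact Or.inl (d₁ ▸ h₂)
  · refine Or.inr ⟨d₁.trans d₂, ?_⟩
    rcases lt_trichotomy i j with h | rfl | h
    · exact ⟨j, hi' j h ▸ hj, fun l hl => (hi' l (h.trans hl)).trans (hj' l hl)⟩
    · exact ⟨i, hj.trans hi, fun l hl => (hi' l hl).trans (hj' l hl)⟩
    · exact ⟨i, hj' i h ▸ hi, fun l hl => (hi' l hl).trans (hj' l (h.trans hl))⟩

theorem DegRevLexLT.asymm {μ ν : Fin n →₀ ℕ} (h₁ : DegRevLexLT μ ν) : ¬ DegRevLexLT ν μ :=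
  fun h₂ => DegRevLexLT.irrefl _ (h₁.trans h₂)

theorem DegRevLexLT.trichotomy (μ ν : Fin n →₀ ℕ) :
    DegRevLexLT μ ν ∨ μ = ν ∨ DegRevLexLT ν μ := by
  rcases lt_trichotomy μ.degree ν.degree with h | h | h
  · exact Or.inl (Or.inl h)
  · by_cases hμν : μ = ν
    · exact Or.inr (Or.inl hμν)
    · obtain ⟨i, hi⟩ := Finsupp.ne_iff.mp hμν
      let s := Finset.univ.filter fun j => μ j ≠ ν j
      have hs : s.Nonempty := ⟨i, by simp [s, hi]⟩
      have hmax : ∀ j, s.max' hs < j → μ j = ν j := fun j hj => by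
        by_contra hne
        exact absurd (s.le_max' j (by simp [s, hne])) (not_le.mpr hj)
      have hmem : μ (s.max' hs) ≠ ν (s.max' hs) := by simpa [s] using s.max'_mem hs
      rcases lt_or_gt_of_ne hmem with hl | hl
      · exact Or.inr (Or.inr (Or.inr ⟨h.symm, _, hl, fun j hj => (hmax j hj).symm⟩))
      · exact Or.inl (Or.inr ⟨h, _, hl, hmax⟩)
  · exact Or.inr (Or.inr (Or.inl h))

theorem DegRevLexLT.add_left {μ ν : Fin n →₀ ℕ} (ρ : Fin n →₀ ℕ) (h : DegRevLexLT μ ν) :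
    DegRevLexLT (ρ + μ) (ρ + ν) := by
  rcases h with h | ⟨d, i, hi, hi'⟩
  · exact Or.inl (by simpa using h)
  · exact Or.inr ⟨by simpa using d, i, by simpa using hi, fun j hj => by simp [hi' j hj]⟩

theorem exists_degRevLex_max (s : Finset (Fin n →₀ ℕ)) (hs : s.Nonempty) :
    ∃ μ ∈ s, ∀ ν ∈ s, ν ≠ μ → DegRevLexLT ν μ := by
  classical
  induction hs using Finset.Nonempty.cons_induction with
  | singleton a => exact ⟨a, by simp, by simp⟩
  | cons a s ha hs ih =>
    obtain ⟨μ, hμ, hmax⟩ := ih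
    have hne : a ≠ μ := fun h => ha (h ▸ hμ)
    rcases DegRevLexLT.trichotomy a μ with h | h | h
    · refine ⟨μ, by simp [hμ], fun ν hν hνμ => ?_⟩
      rcases Finset.mem_cons.mp hν with rfl | hν
      · exact h
      · exact hmax ν hν hνμ
    · exact absurd h hne
    · refine ⟨a, by simp, fun ν hν hνa => ?_⟩
      rcases Finset.mem_cons.mp hν with rfl | hν
      · exact absurd rfl hνa
      · by_cases hνμ : ν = μ
        · exact hνμ ▸ h
        · exact (hmax ν hν hνμ).trans h

end DegRevLex

/-! ### Leading ideals described by their sets of exponents. -/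

section LeadingExponents

theorem exists_isLeadingExponent {f : MvPolynomial (Fin n) k} (hf : f ≠ 0) :
    ∃ μ, IsLeadingExponent f μ :=
  exists_degRevLex_max f.support (by simpa [Finset.nonempty_iff_ne_empty] using hf)

theorem isLeadingExponent_monomial (μ : Fin n →₀ ℕ) :
    IsLeadingExponent (monomial μ (1 : k)) μ := by
  classical
  refine ⟨by simp, fun ν hν hne => ?_⟩
  rw [mem_support_iff, coeff_monomial] at hν
  exact absurd (by simpa using hν : μ = ν).symm hne

theorem IsLeadingExponent.monomial_mul {f : MvPolynomial (Fin n) k} {μ : Fin n →₀ ℕ}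
    (h : IsLeadingExponent f μ) (ρ : Fin n →₀ ℕ) :
    IsLeadingExponent (monomial ρ 1 * f) (ρ + μ) := by
  refine ⟨by simpa [mem_support_iff, coeff_monomial_mul] using h.1, fun ν hν hne => ?_⟩
  rw [mem_support_iff, coeff_monomial_mul'] at hν
  split_ifs at hν with hle
  · obtain ⟨τ, rfl⟩ := exists_add_of_le hle
    rw [add_tsub_cancel_left, one_mul] at hν
    exact (h.2 τ (mem_support_iff.mpr hν) fun hτ => hne (hτ ▸ rfl)).add_left ρ
  · exact absurd rfl hν

/-- The exponents of the leading terms of the nonzero elements of `J`. -/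
def leadingExponents (J : Ideal (MvPolynomial (Fin n) k)) : Set (Fin n →₀ ℕ) :=
  {μ | ∃ f ∈ J, IsLeadingExponent f μ}

theorem leadingIdeal_eq_span (J : Ideal (MvPolynomial (Fin n) k)) :
    leadingIdeal J = Ideal.span ((fun μ => monomial μ (1 : k)) '' leadingExponents J) := by
  refine congrArg Ideal.span (Set.ext fun t => ⟨?_, ?_⟩)
  · rintro ⟨f, hf, μ, hμ, rfl⟩
    exact ⟨μ, ⟨f, hf, hμ⟩, rfl⟩
  · rintro ⟨μ, ⟨f, hf, hμ⟩, rfl⟩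
    exact ⟨f, hf, μ, hμ, rfl⟩

theorem leadingExponents_upward {J : Ideal (MvPolynomial (Fin n) k)} {μ ν : Fin n →₀ ℕ}
    (hμ : μ ∈ leadingExponents J) (h : μ ≤ ν) : ν ∈ leadingExponents J := by
  obtain ⟨f, hf, hfμ⟩ := hμ
  refine ⟨monomial (ν - μ) 1 * f, J.mul_mem_left _ hf, ?_⟩
  simpa [tsub_add_cancel_of_le h] using hfμ.monomial_mul (ν - μ)

theorem mem_leadingIdeal_iff {J : Ideal (MvPolynomial (Fin n) k)} {f : MvPolynomial (Fin n) k} :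
    f ∈ leadingIdeal J ↔ ∀ μ ∈ f.support, μ ∈ leadingExponents J := by
  rw [leadingIdeal_eq_span, mem_ideal_span_monomial_image]
  exact forall₂_congr fun μ _ =>
    ⟨fun ⟨ν, hν, hle⟩ => leadingExponents_upward hν hle, fun h => ⟨μ, h, le_rfl⟩⟩

theorem monomial_mem_leadingIdeal_iff {J : Ideal (MvPolynomial (Fin n) k)} {μ : Fin n →₀ ℕ} :
    monomial μ (1 : k) ∈ leadingIdeal J ↔ μ ∈ leadingExponents J := by
  classical
  rw [mem_leadingIdeal_iff, support_monomial]
  simp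

theorem leadingExponents_leadingIdeal (J : Ideal (MvPolynomial (Fin n) k)) :
    leadingExponents (leadingIdeal J) = leadingExponents J := by
  ext μ
  refine ⟨fun ⟨f, hf, hμ⟩ => mem_leadingIdeal_iff.mp hf μ hμ.1, fun h => ?_⟩
  exact ⟨_, monomial_mem_leadingIdeal_iff.mpr h, isLeadingExponent_monomial μ⟩

theorem leadingIdeal_leadingIdeal (J : Ideal (MvPolynomial (Fin n) k)) :
    leadingIdeal (leadingIdeal J) = leadingIdeal J := by
  rw [leadingIdeal_eq_span, leadingExponents_leadingIdeal, ← leadingIdeal_eq_span]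

end LeadingExponents

/-! ### Linear coordinate changes, homogeneity and the generic matrix. -/

section CoordChange

theorem coordChange_X (A : GL (Fin n) k) (i : Fin n) :
    coordChange A (X i) = ∑ j, C ((A : Matrix (Fin n) (Fin n) k) i j) * X j := by
  simp [coordChange]

theorem coordChange_one : coordChange (1 : GL (Fin n) k) = AlgHom.id k _ := by
  refine algHom_ext fun i => ?_
  rw [coordChange_X, Finset.sum_eq_single i]
  · simp
  · intro j _ hj
    simp [Matrix.one_apply_ne hj.symm]
  · simp

theorem coordChange_comp (A B : GL (Fin n) k) :
    (coordChange A).comp (coordChange B) = coordChange (B * A) := by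
  refine algHom_ext fun i => ?_
  simp only [AlgHom.comp_apply, coordChange_X, map_sum, map_mul, algHom_C, Units.val_mul,
    Matrix.mul_apply, Finset.sum_mul, Finset.mul_sum, algebraMap_eq]
  rw [Finset.sum_comm]
  simp only [mul_assoc]

theorem coordChange_surjective (A : GL (Fin n) k) : Function.Surjective (coordChange A) := by
  intro f
  refine ⟨coordChange A⁻¹ f, ?_⟩
  rw [← AlgHom.comp_apply, coordChange_comp, inv_mul_cancel, coordChange_one, AlgHom.id_apply]

theorem transform_one (I : Ideal (MvPolynomial (Fin n) k)) : transform 1 I = I := by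
  rw [transform, coordChange_one]
  exact Ideal.map_id I

theorem mem_transform_iff {A : GL (Fin n) k} {I : Ideal (MvPolynomial (Fin n) k)}
    {f : MvPolynomial (Fin n) k} : f ∈ transform A I ↔ ∃ g ∈ I, coordChange A g = f :=
  Ideal.mem_map_iff_of_surjective _ (coordChange_surjective A)

theorem isHomogeneous_coordChange (A : GL (Fin n) k) {f : MvPolynomial (Fin n) k} {q : ℕ}
    (hf : f.IsHomogeneous q) : (coordChange A f).IsHomogeneous q := by
  have := hf.aeval (fun i => ∑ j, C ((A : Matrix (Fin n) (Fin n) k) i j) * X j) (n := 1)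
    fun i => IsHomogeneous.sum _ _ _ fun j _ => isHomogeneous_C_mul_X _ _
  simpa [coordChange] using this

theorem homogeneousComponent_coordChange (A : GL (Fin n) k) (f : MvPolynomial (Fin n) k) (q : ℕ) :
    homogeneousComponent q (coordChange A f) = coordChange A (homogeneousComponent q f) := by
  conv_lhs => rw [← sum_homogeneousComponent f]
  rw [map_sum, map_sum]
  have h : ∀ i, homogeneousComponent q (coordChange A (homogeneousComponent i f)) =
      if i = q then coordChange A (homogeneousComponent q f) else 0 := fun i => by
    rw [homogeneousComponent_of_mem
      (isHomogeneous_coordChange A (homogeneousComponent_isHomogeneous i f))]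
    split_ifs with h₁ h₂ h₂ <;> grind
  simp only [h, Finset.sum_ite_eq', Finset.mem_range]
  split_ifs with hq
  · rfl
  · rw [homogeneousComponent_eq_zero q f (by omega), map_zero]

theorem IsLeadingExponent.homogeneousComponent {f : MvPolynomial (Fin n) k} {μ : Fin n →₀ ℕ}
    (h : IsLeadingExponent f μ) :
    IsLeadingExponent (MvPolynomial.homogeneousComponent μ.degree f) μ := by
  classical
  refine ⟨by simpa [mem_support_iff, coeff_homogeneousComponent] using h.1, fun ν hν hne => ?_⟩
  refine h.2 ν ?_ hne
  rw [mem_support_iff, coeff_homogeneousComponent] at hν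
  rw [mem_support_iff]
  grind

/-- Coordinate changes commute with taking homogeneous components, so a witness may be replaced by
its component in the degree of its leading term. -/
theorem mem_leadingExponents_transform_iff {I : Ideal (MvPolynomial (Fin n) k)}
    (hI : I.IsHomogeneous (homogeneousSubmodule (Fin n) k)) {A : GL (Fin n) k}
    {μ : Fin n →₀ ℕ} :
    μ ∈ leadingExponents (transform A I) ↔
      ∃ f ∈ I, f.IsHomogeneous μ.degree ∧ IsLeadingExponent (coordChange A f) μ := by
  constructor
  · rintro ⟨f, hf, hμ⟩
    obtain ⟨g, hg, rfl⟩ := mem_transform_iff.mp hf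
    refine ⟨homogeneousComponent μ.degree g, homogeneousComponent_mem_of_mem hI hg _,
      homogeneousComponent_isHomogeneous _ _, ?_⟩
    rw [← homogeneousComponent_coordChange]
    exact hμ.homogeneousComponent
  · rintro ⟨f, hf, -, hμ⟩
    exact ⟨_, mem_transform_iff.mpr ⟨f, hf, rfl⟩, hμ⟩

/-- The change of coordinates by the matrix of indeterminates. -/
noncomputable def genericCoordChange (n : ℕ) (k : Type*) [Field k] :
    MvPolynomial (Fin n) k →ₐ[k] MvPolynomial (Fin n) (MvPolynomial (Fin n × Fin n) k) :=
  aeval fun i => ∑ j, C (X (i, j)) * X j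

/-- The value of a polynomial in the matrix entries at `A`. -/
noncomputable def evalAt (A : GL (Fin n) k) : MvPolynomial (Fin n × Fin n) k →+* k :=
  eval fun ij => (A : Matrix (Fin n) (Fin n) k) ij.1 ij.2

theorem map_genericCoordChange (A : GL (Fin n) k) (f : MvPolynomial (Fin n) k) :
    map (evalAt A) (genericCoordChange n k f) = coordChange A f := by
  have h : (map (evalAt A)).comp (genericCoordChange n k).toRingHom = (coordChange A).toRingHom := by
    refine ringHom_ext (fun c => ?_) fun i => ?_
    · simp [genericCoordChange, evalAt, MvPolynomial.algebraMap_apply]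
    · simp [genericCoordChange, evalAt, coordChange]
  exact congrArg (fun φ : MvPolynomial (Fin n) k →+* MvPolynomial (Fin n) k => φ f) h

theorem evalAt_coeff_genericCoordChange (A : GL (Fin n) k) (f : MvPolynomial (Fin n) k)
    (μ : Fin n →₀ ℕ) :
    evalAt A (coeff μ (genericCoordChange n k f)) = coeff μ (coordChange A f) := by
  rw [← map_genericCoordChange, coeff_map]

end CoordChange

/-! ### Lower semicontinuity of the number of leading terms in an upper slice. -/

section Semicontinuity

/-- `T` is a set of exponents of degree `q` closed under passing to larger ones. -/
def IsUpperSlice (q : ℕ) (T : Finset (Fin n →₀ ℕ)) : Prop :=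
  (∀ μ ∈ T, μ.degree = q) ∧
    ∀ μ ∈ T, ∀ ν : Fin n →₀ ℕ, ν.degree = q → DegRevLexLT μ ν → ν ∈ T

open Classical in
/-- The leading exponents of `J` that lie in `T`. -/
noncomputable def leadingIn (J : Ideal (MvPolynomial (Fin n) k)) (T : Finset (Fin n →₀ ℕ)) :
    Finset (Fin n →₀ ℕ) :=
  T.filter (· ∈ leadingExponents J)

theorem mem_leadingIn {J : Ideal (MvPolynomial (Fin n) k)} {T : Finset (Fin n →₀ ℕ)}
    {μ : Fin n →₀ ℕ} : μ ∈ leadingIn J T ↔ μ ∈ T ∧ μ ∈ leadingExponents J := by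
  simp [leadingIn]

/-- The matrix is triangular for the term order with nonzero diagonal: in a vanishing combination of
rows, look at the column of the largest index that occurs. -/
theorem det_coeff_ne_zero_of_isLeadingExponent (E : Finset (Fin n →₀ ℕ))
    (g : E → MvPolynomial (Fin n) k) (hg : ∀ μ : E, IsLeadingExponent (g μ) μ) :
    (Matrix.of fun μ ν : E => coeff (ν : Fin n →₀ ℕ) (g μ)).det ≠ 0 := by
  classical
  intro h
  obtain ⟨v, hv, hv0⟩ := Matrix.exists_vecMul_eq_zero_iff.mpr h
  obtain ⟨μ₀, hμ₀⟩ := Function.ne_iff.mp hv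
  obtain ⟨μ, hμ, hmax⟩ := exists_degRevLex_max
    ((Finset.univ.filter fun μ : E => v μ ≠ 0).image Subtype.val)
    ⟨μ₀, Finset.mem_image_of_mem _ (by simpa using hμ₀)⟩
  obtain ⟨μ, hvμ, rfl⟩ := Finset.mem_image.mp hμ
  have h0 := congrFun hv0 μ
  rw [Matrix.vecMul, dotProduct, Finset.sum_eq_single μ] at h0
  · exact mul_ne_zero (by simpa using hvμ) (mem_support_iff.mp (hg μ).1) h0
  · intro ν _ hν
    by_contra hne
    have h₁ : DegRevLexLT (ν : Fin n →₀ ℕ) μ := by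
      refine hmax ν (Finset.mem_image_of_mem _ ?_) (fun h => hν (Subtype.ext h))
      simpa using left_ne_zero_of_mul hne
    have h₂ : DegRevLexLT (μ : Fin n →₀ ℕ) ν :=
      (hg ν).2 μ (mem_support_iff.mpr (right_ne_zero_of_mul hne))
        (fun h => hν (Subtype.ext h.symm))
    exact h₁.asymm h₂
  · simp

/-- If some coefficient in `T` were nonzero, the leading exponent of `f` would lie in `T` by upward
closure. This bounds the rank of the projection to `T` by the number of leading exponents there. -/
theorem coeff_eq_zero_of_leadingIn {J : Ideal (MvPolynomial (Fin n) k)} {q : ℕ}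
    {T : Finset (Fin n →₀ ℕ)} (hT : IsUpperSlice q T) {f : MvPolynomial (Fin n) k} (hf : f ∈ J)
    (hq : f.IsHomogeneous q) (h : ∀ μ ∈ leadingIn J T, coeff μ f = 0) :
    ∀ μ ∈ T, coeff μ f = 0 := by
  intro μ hμ
  by_contra hne
  obtain ⟨ν, hν⟩ := exists_isLeadingExponent (f := f) (by rintro rfl; simp at hne)
  have hνT : ν ∈ T := by
    by_cases hμν : μ = ν
    · exact hμν ▸ hμ
    · refine hT.2 μ hμ ν ?_ (hν.2 μ (mem_support_iff.mpr hne) hμν)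
      by_contra hd
      exact mem_support_iff.mp hν.1 (hq.coeff_eq_zero hd)
  exact mem_support_iff.mp hν.1 (h ν (mem_leadingIn.mpr ⟨hνT, f, hf, hν⟩))

theorem card_leadingIn_semicontinuous {I : Ideal (MvPolynomial (Fin n) k)}
    (hI : I.IsHomogeneous (homogeneousSubmodule (Fin n) k)) {q : ℕ}
    {T : Finset (Fin n →₀ ℕ)} (hT : IsUpperSlice q T) (B : GL (Fin n) k) :
    ∃ p : MvPolynomial (Fin n × Fin n) k, evalAt B p ≠ 0 ∧ ∀ A : GL (Fin n) k, evalAt A p ≠ 0 →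
      (leadingIn (transform B I) T).card ≤ (leadingIn (transform A I) T).card := by
  classical
  set E := leadingIn (transform B I) T with hE
  have hf : ∀ μ : E, ∃ f ∈ I, f.IsHomogeneous q ∧ IsLeadingExponent (coordChange B f) μ := by
    rintro ⟨μ, hμ⟩
    obtain ⟨hμT, hμ⟩ := mem_leadingIn.mp hμ
    obtain ⟨f, hf, hfq, hfμ⟩ := (mem_leadingExponents_transform_iff hI).mp hμ
    exact ⟨f, hf, hT.1 μ hμT ▸ hfq, hfμ⟩
  choose f hfI hfq hfB using hf
  -- The minor, over the generic matrix, whose nonvanishing at `B` persists on an open set.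
  let M : Matrix E E (MvPolynomial (Fin n × Fin n) k) :=
    Matrix.of fun μ ν => coeff (ν : Fin n →₀ ℕ) (genericCoordChange n k (f μ))
  have hM : ∀ A : GL (Fin n) k, evalAt A M.det =
      (Matrix.of fun μ ν : E => coeff (ν : Fin n →₀ ℕ) (coordChange A (f μ))).det := fun A => by
    rw [RingHom.map_det]
    congr 1
    ext μ ν
    exact evalAt_coeff_genericCoordChange A _ _
  refine ⟨M.det, ?_, fun A hA => ?_⟩
  · rw [hM]
    exact det_coeff_ne_zero_of_isLeadingExponent E _ hfB
  · rw [hM] at hA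
    set F := leadingIn (transform A I) T with hF
    let w : E → F → k := fun μ ν => coeff (ν : Fin n →₀ ℕ) (coordChange A (f μ))
    have hw : LinearIndependent k w := by
      rw [Fintype.linearIndependent_iff]
      intro c hc
      -- A relation among the coordinates in `F` extends to all of `T`, hence to `E`, where the
      -- minor forbids it.
      have hzero : ∀ ν ∈ T, coeff ν (coordChange A (∑ μ, C (c μ) * f μ)) = 0 := by
        refine coeff_eq_zero_of_leadingIn (J := transform A I) hT
          (mem_transform_iff.mpr ⟨_, sum_mem fun μ _ => I.mul_mem_left _ (hfI μ), rfl⟩)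
          (isHomogeneous_coordChange A (IsHomogeneous.sum _ _ _ fun μ _ => (hfq μ).C_mul _))
          fun ν hν => ?_
        simpa [w, coeff_sum, algHom_C, algebraMap_eq, coeff_C_mul] using congrFun hc ⟨ν, hν⟩
      by_contra! hne
      obtain ⟨i, hi⟩ := hne
      refine hA (Matrix.exists_vecMul_eq_zero_iff.mp ⟨c, fun h => hi (congrFun h i), ?_⟩)
      ext ν
      simpa [Matrix.vecMul, dotProduct, coeff_sum, algHom_C, algebraMap_eq, coeff_C_mul] using
        hzero ν (mem_leadingIn.mp ν.2).1
    simpa using hw.fintype_card_le_finrank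

end Semicontinuity

/-! ### Simultaneous maximality for generic matrices. -/

section Genericity

/-- A polynomial in the matrix entries that does not vanish identically on `GL(n, k)`. -/
def IsNonvanishing (p : MvPolynomial (Fin n × Fin n) k) : Prop :=
  ∃ A : GL (Fin n) k, evalAt A p ≠ 0

/-- Over an infinite field `p * det` is nonzero at some point, and that point is an invertible
matrix. -/
theorem isNonvanishing_of_ne_zero [Infinite k] {p : MvPolynomial (Fin n × Fin n) k} (hp : p ≠ 0) :
    IsNonvanishing p := by
  classical
  let D : MvPolynomial (Fin n × Fin n) k := (Matrix.of fun i j => X (i, j)).det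
  have hD : ∀ x : Fin n × Fin n → k, eval x D = (Matrix.of fun i j => x (i, j)).det := fun x => by
    rw [RingHom.map_det]
    congr 1
    ext i j
    simp
  have hD0 : D ≠ 0 := fun h => by
    have h1 := hD fun ij => (1 : Matrix (Fin n) (Fin n) k) ij.1 ij.2
    rw [h, map_zero] at h1
    exact zero_ne_one (h1.trans Matrix.det_one)
  obtain ⟨x, hx⟩ : ∃ x, eval x (p * D) ≠ 0 := by
    by_contra! h
    exact mul_ne_zero hp hD0 (MvPolynomial.funext fun x => by simpa using h x)
  rw [map_mul, hD] at hx
  exact ⟨Matrix.GeneralLinearGroup.mkOfDetNeZero _ (right_ne_zero_of_mul hx),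
    left_ne_zero_of_mul hx⟩

theorem IsNonvanishing.ne_zero {p : MvPolynomial (Fin n × Fin n) k} (hp : IsNonvanishing p) :
    p ≠ 0 := by
  rintro rfl
  obtain ⟨A, hA⟩ := hp
  exact hA (map_zero _)

theorem IsNonvanishing.mul [Infinite k] {p r : MvPolynomial (Fin n × Fin n) k}
    (hp : IsNonvanishing p) (hr : IsNonvanishing r) : IsNonvanishing (p * r) :=
  isNonvanishing_of_ne_zero (mul_ne_zero hp.ne_zero hr.ne_zero)

theorem isNonvanishing_prod [Infinite k] {ι : Type*} (s : Finset ι)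
    (p : ι → MvPolynomial (Fin n × Fin n) k) (hp : ∀ i ∈ s, IsNonvanishing (p i)) :
    IsNonvanishing (∏ i ∈ s, p i) :=
  isNonvanishing_of_ne_zero (Finset.prod_ne_zero_iff.mpr fun i hi => (hp i hi).ne_zero)

theorem evalAt_ne_zero_of_prod {ι : Type*} {s : Finset ι}
    {p : ι → MvPolynomial (Fin n × Fin n) k} {A : GL (Fin n) k}
    (h : evalAt A (∏ i ∈ s, p i) ≠ 0) : ∀ i ∈ s, evalAt A (p i) ≠ 0 := by
  rw [map_prod] at h
  exact Finset.prod_ne_zero_iff.mp h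

theorem exists_card_leadingIn_max {I : Ideal (MvPolynomial (Fin n) k)}
    (hI : I.IsHomogeneous (homogeneousSubmodule (Fin n) k)) {q : ℕ}
    {T : Finset (Fin n →₀ ℕ)} (hT : IsUpperSlice q T) :
    ∃ p : MvPolynomial (Fin n × Fin n) k, IsNonvanishing p ∧
      ∀ A B : GL (Fin n) k, evalAt A p ≠ 0 →
        (leadingIn (transform B I) T).card ≤ (leadingIn (transform A I) T).card := by
  classical
  have hbdd : BddAbove (Set.range fun B : GL (Fin n) k => (leadingIn (transform B I) T).card) :=
    ⟨T.card, by rintro _ ⟨B, rfl⟩; exact Finset.card_filter_le _ _⟩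
  obtain ⟨B₀, hB₀⟩ := Nat.sSup_mem (Set.range_nonempty _) hbdd
  obtain ⟨p, hp, hpA⟩ := card_leadingIn_semicontinuous hI hT B₀
  refine ⟨p, ⟨B₀, hp⟩, fun A B hA => le_trans ?_ (hpA A hA)⟩
  exact (le_csSup hbdd ⟨B, rfl⟩).trans hB₀.ge

theorem finite_isUpperSlice (n q : ℕ) :
    {T : Finset (Fin n →₀ ℕ) | IsUpperSlice q T}.Finite := by
  refine ((Finsupp.finite_of_degree_eq q).toFinset.powerset.finite_toSet).subset fun T hT => ?_
  simp only [Finset.coe_powerset, Set.mem_preimage, Set.mem_powerset_iff]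
  intro μ hμ
  simpa using hT.1 μ hμ

theorem mem_leadingExponents_iff_card {J : Ideal (MvPolynomial (Fin n) k)} {μ : Fin n →₀ ℕ}
    {T : Finset (Fin n →₀ ℕ)} (hμ : μ ∉ T) [DecidableEq (Fin n →₀ ℕ)] :
    μ ∈ leadingExponents J ↔ (leadingIn J T).card < (leadingIn J (insert μ T)).card := by
  classical
  rw [leadingIn, leadingIn, Finset.filter_insert]
  split_ifs with h
  · rw [Finset.card_insert_of_notMem (by simp [hμ])]
    simp [h]
  · simp [h]

/-- Both the terms above `μ` and those together with `μ` form upper slices; comparing the two counts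
detects `μ`. -/
theorem leadingExponents_eq_of_card {J K : Ideal (MvPolynomial (Fin n) k)} {q : ℕ}
    (h : ∀ T, IsUpperSlice q T → (leadingIn J T).card = (leadingIn K T).card)
    {μ : Fin n →₀ ℕ} (hμ : μ.degree = q) :
    μ ∈ leadingExponents J ↔ μ ∈ leadingExponents K := by
  classical
  let T := (Finsupp.finite_of_degree_eq (σ := Fin n) q).toFinset.filter fun ν => DegRevLexLT μ ν
  have hT : ∀ ν, ν ∈ T ↔ ν.degree = q ∧ DegRevLexLT μ ν := by simp [T]
  have hT1 : IsUpperSlice q T := ⟨fun ν hν => ((hT ν).mp hν).1, fun ν hν ρ hρ hlt =>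
    (hT ρ).mpr ⟨hρ, ((hT ν).mp hν).2.trans hlt⟩⟩
  have hT2 : IsUpperSlice q (insert μ T) := by
    refine ⟨fun ν hν => ?_, fun ν hν ρ hρ hlt => ?_⟩
    · rcases Finset.mem_insert.mp hν with rfl | hν
      · exact hμ
      · exact hT1.1 ν hν
    · refine Finset.mem_insert_of_mem ?_
      rcases Finset.mem_insert.mp hν with rfl | hν
      · exact (hT ρ).mpr ⟨hρ, hlt⟩
      · exact hT1.2 ν hν ρ hρ hlt
  have hμT : μ ∉ T := fun hm => DegRevLexLT.irrefl μ ((hT μ).mp hm).2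
  rw [mem_leadingExponents_iff_card hμT, mem_leadingExponents_iff_card hμT, h _ hT1, h _ hT2]

theorem exists_generic_degree [Infinite k] {I : Ideal (MvPolynomial (Fin n) k)}
    (hI : I.IsHomogeneous (homogeneousSubmodule (Fin n) k)) (q : ℕ) :
    ∃ p : MvPolynomial (Fin n × Fin n) k, IsNonvanishing p ∧
      ∀ A B : GL (Fin n) k, evalAt A p ≠ 0 → ∀ T, IsUpperSlice q T →
        (leadingIn (transform B I) T).card ≤ (leadingIn (transform A I) T).card := by
  choose p hp hpA using fun T : {T : Finset (Fin n →₀ ℕ) // IsUpperSlice q T} =>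
    exists_card_leadingIn_max hI T.2
  have : Fintype {T : Finset (Fin n →₀ ℕ) // IsUpperSlice q T} :=
    (finite_isUpperSlice n q).fintype
  exact ⟨∏ T, p T, isNonvanishing_prod _ _ fun T _ => hp T, fun A B hA T hT =>
    hpA ⟨T, hT⟩ A B (evalAt_ne_zero_of_prod hA _ (Finset.mem_univ _))⟩

theorem isUpperSlice_univ (n q : ℕ) :
    IsUpperSlice q (Finsupp.finite_of_degree_eq (σ := Fin n) q).toFinset :=
  ⟨fun μ hμ => by simpa using hμ, fun μ _ ν hν _ => by simpa using hν⟩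

/-- Dickson's lemma: the minimal elements form an antichain in a well-quasi-order. -/
theorem exists_finset_forall_exists_le (L : Set (Fin n →₀ ℕ)) :
    ∃ t : Finset (Fin n →₀ ℕ), ↑t ⊆ L ∧ ∀ μ ∈ L, ∃ ν ∈ t, ν ≤ μ := by
  have hfin : {μ | Minimal (· ∈ L) μ}.Finite :=
    WellQuasiOrderedLE.finite_of_isAntichain (setOfPred_minimal_antichain _)
  refine ⟨hfin.toFinset, fun μ hμ => ?_, fun μ hμ => ?_⟩
  · have : Minimal (· ∈ L) μ := by simpa using hμ
    exact this.prop
  · obtain ⟨ν, hle, hν⟩ := exists_minimal_le_of_wellFoundedLT (· ∈ L) μ hμ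
    exact ⟨ν, by simpa using hν, hle⟩

theorem exists_set_of_degreewise (L : ℕ → Set (Fin n →₀ ℕ)) :
    ∃ L' : Set (Fin n →₀ ℕ), ∀ μ, μ ∈ L' ↔ μ ∈ L μ.degree :=
  ⟨{μ | μ ∈ L μ.degree}, fun _ => Iff.rfl⟩

theorem exists_generic [Infinite k] {I : Ideal (MvPolynomial (Fin n) k)}
    (hI : I.IsHomogeneous (homogeneousSubmodule (Fin n) k)) :
    ∃ p : MvPolynomial (Fin n × Fin n) k, IsNonvanishing p ∧ ∃ J,
      (∀ A : GL (Fin n) k, evalAt A p ≠ 0 → leadingIdeal (transform A I) = J) ∧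
      ∀ (A B : GL (Fin n) k), evalAt A p ≠ 0 → ∀ (q : ℕ) (T), IsUpperSlice q T →
        (leadingIn (transform B I) T).card ≤ (leadingIn (transform A I) T).card := by
  classical
  choose p hp hpA using exists_generic_degree hI
  choose G hG using hp
  -- Each degree of `L` comes from its own generic matrix, so `L` is not yet known to be closed
  -- under multiples.
  obtain ⟨L, hL⟩ := exists_set_of_degreewise fun q => leadingExponents (transform (G q) I)
  have hpL : ∀ (A : GL (Fin n) k) (μ : Fin n →₀ ℕ), evalAt A (p μ.degree) ≠ 0 →
      (μ ∈ leadingExponents (transform A I) ↔ μ ∈ L) := fun A μ hA => by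
    rw [hL]
    exact leadingExponents_eq_of_card (fun T hT => le_antisymm (hpA _ _ _ (hG _) T hT)
      (hpA _ _ _ hA T hT)) rfl
  obtain ⟨t, htL, ht⟩ := exists_finset_forall_exists_le L
  have hmain : ∀ A : GL (Fin n) k, evalAt A (∏ μ ∈ t, p μ.degree) ≠ 0 →
      leadingExponents (transform A I) = L := by
    intro A hA
    -- Genericity in the degrees of the finite set `t` suffices, since the leading exponents of `A ·
    -- I` are closed under multiples.
    have hsub : L ⊆ leadingExponents (transform A I) := by
      intro μ hμ
      obtain ⟨ν, hν, hle⟩ := ht μ hμ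
      exact leadingExponents_upward
        ((hpL A ν (evalAt_ne_zero_of_prod hA ν hν)).mpr (htL hν)) hle
    refine Set.Subset.antisymm (fun μ hμ => ?_) hsub
    have hss : leadingIn (transform (G μ.degree) I)
        (Finsupp.finite_of_degree_eq (σ := Fin n) μ.degree).toFinset ⊆
        leadingIn (transform A I)
          (Finsupp.finite_of_degree_eq (σ := Fin n) μ.degree).toFinset := by
      intro ν hν
      obtain ⟨hν1, hν2⟩ := mem_leadingIn.mp hν
      have hdeg : ν.degree = μ.degree := by simpa using hν1
      exact mem_leadingIn.mpr ⟨hν1, hsub ((hL ν).mpr (hdeg.symm ▸ hν2))⟩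
    -- In the remaining degrees equality is forced by counting: `G μ.degree` already has the maximal
    -- number of leading exponents.
    have heq := Finset.eq_of_subset_of_card_le hss
      (hpA _ _ _ (hG _) _ (isUpperSlice_univ n μ.degree))
    have : μ ∈ leadingIn (transform A I)
        (Finsupp.finite_of_degree_eq (σ := Fin n) μ.degree).toFinset :=
      mem_leadingIn.mpr ⟨by simp, hμ⟩
    rw [← heq] at this
    exact (hL μ).mpr (mem_leadingIn.mp this).2
  refine ⟨∏ μ ∈ t, p μ.degree, isNonvanishing_prod _ _ fun μ _ => ⟨_, hG μ.degree⟩,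
    Ideal.span ((fun μ => monomial μ (1 : k)) '' L), fun A hA => ?_, fun A B hA q T hT => ?_⟩
  · rw [leadingIdeal_eq_span, hmain A hA]
  · refine (hpA q (G q) B (hG q) T hT).trans (Finset.card_le_card fun μ hμ => ?_)
    obtain ⟨hμT, hμ⟩ := mem_leadingIn.mp hμ
    refine mem_leadingIn.mpr ⟨hμT, ?_⟩
    rw [hmain A hA, hL, hT.1 μ hμT]
    exact hμ

end Genericity

/-! ### Uniqueness and characterization of the generic initial ideal. -/

section Gin

theorem IsGenericInitialIdeal.unique [Infinite k] {I J K : Ideal (MvPolynomial (Fin n) k)}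
    (hJ : IsGenericInitialIdeal I J) (hK : IsGenericInitialIdeal I K) : J = K := by
  obtain ⟨U, ⟨S, rfl⟩, ⟨A, p, hpS, hp⟩, hUJ⟩ := hJ
  obtain ⟨V, ⟨R, rfl⟩, ⟨B, r, hrR, hr⟩, hVK⟩ := hK
  obtain ⟨D, hD⟩ := IsNonvanishing.mul (p := p) (r := r) ⟨A, hp⟩ ⟨B, hr⟩
  rw [map_mul] at hD
  rw [← hUJ D ⟨p, hpS, left_ne_zero_of_mul hD⟩, ← hVK D ⟨r, hrR, right_ne_zero_of_mul hD⟩]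

theorem gin_spec [Infinite k] {I : Ideal (MvPolynomial (Fin n) k)}
    (hI : I.IsHomogeneous (homogeneousSubmodule (Fin n) k)) :
    IsGenericInitialIdeal I (gin I) ∧ ∃ A : GL (Fin n) k,
      gin I = leadingIdeal (transform A I) ∧
      ∀ (B : GL (Fin n) k) (q : ℕ) (T), IsUpperSlice q T →
        (leadingIn (transform B I) T).card ≤ (leadingIn (transform A I) T).card := by
  obtain ⟨p, ⟨A, hA⟩, J, hJ, hmax⟩ := exists_generic hI
  have hgen : IsGenericInitialIdeal I J :=
    ⟨{B | ∃ r ∈ ({p} : Set _), evalAt B r ≠ 0}, ⟨{p}, rfl⟩, ⟨A, p, rfl, hA⟩, fun B hB => by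
      obtain ⟨r, rfl, hr⟩ := hB
      exact hJ B hr⟩
  have hex : ∃ J, IsGenericInitialIdeal I J := ⟨J, hgen⟩
  have hgin : IsGenericInitialIdeal I (gin I) := by
    rw [gin, dif_pos hex]
    exact hex.choose_spec
  exact ⟨hgin, A, (hgin.unique hgen).trans (hJ A hA).symm, fun B => hmax A B hA⟩

end Gin

/-! ### The `β`-vector as differences of slice counts. -/

section Beta

theorem maxIndex_le_iff {μ : Fin n →₀ ℕ} {i : Fin n} :
    maxIndex μ ≤ (i : ℕ) + 1 ↔ ∀ j, i < j → μ j = 0 := by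
  rw [maxIndex]
  split_ifs with h
  · simp [h]
  · rw [Finset.sup_le_iff]
    refine ⟨fun H j hj => ?_, fun H j hj => ?_⟩
    · by_contra hne
      have := H j (Finsupp.mem_support_iff.mpr hne)
      exact absurd (Fin.lt_def.mp hj) (by omega)
    · by_contra hlt
      exact Finsupp.mem_support_iff.mp hj (H j (Fin.lt_def.mpr (by omega)))

theorem one_le_maxIndex (μ : Fin n →₀ ℕ) : 1 ≤ maxIndex μ := by
  rw [maxIndex]
  split_ifs with h
  · exact le_rfl
  · obtain ⟨i, hi⟩ := Finsupp.support_nonempty_iff.mpr h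
    exact (Nat.le_add_left 1 (i : ℕ)).trans
      (Finset.le_sup (f := fun i : Fin n => (i : ℕ) + 1) hi)

open Classical in
/-- The exponents `μ` of degree `q` with `m(x^μ) ≤ i + 1`. -/
noncomputable def initialSlice (n q : ℕ) (i : Fin n) : Finset (Fin n →₀ ℕ) :=
  (Finsupp.finite_of_degree_eq (σ := Fin n) q).toFinset.filter fun μ => maxIndex μ ≤ (i : ℕ) + 1

theorem mem_initialSlice {q : ℕ} {i : Fin n} {μ : Fin n →₀ ℕ} :
    μ ∈ initialSlice n q i ↔ μ.degree = q ∧ maxIndex μ ≤ (i : ℕ) + 1 := by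
  simp [initialSlice]

/-- Specific to the reverse lexicographic order: at the last index where they differ the larger term
has the smaller exponent, so it cannot acquire a variable beyond index `i`. -/
theorem isUpperSlice_initialSlice (q : ℕ) (i : Fin n) : IsUpperSlice q (initialSlice n q i) := by
  refine ⟨fun μ hμ => (mem_initialSlice.mp hμ).1, fun μ hμ ν hν hlt => ?_⟩
  obtain ⟨hd, hm⟩ := mem_initialSlice.mp hμ
  rw [maxIndex_le_iff] at hm
  refine mem_initialSlice.mpr ⟨hν, maxIndex_le_iff.mpr fun j hj => ?_⟩
  rcases hlt with hlt | ⟨-, l, hl, hl'⟩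
  · omega
  · rcases lt_or_ge l j with hlj | hjl
    · rw [← hl' j hlj, hm j hj]
    · have := hm l (hj.trans_le hjl)
      omega

theorem card_leadingIn_initialSlice (J : Ideal (MvPolynomial (Fin n) k)) (q : ℕ) (i : Fin n) :
    (leadingIn J (initialSlice n q i)).card = ∑ j ∈ Finset.Iic i, betaVector J q j := by
  classical
  have hmaps : ∀ μ ∈ leadingIn J (initialSlice n q i),
      maxIndex μ ∈ (Finset.Iic i).image fun j : Fin n => (j : ℕ) + 1 := fun μ hμ => by
    have h₁ := (mem_initialSlice.mp (mem_leadingIn.mp hμ).1).2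
    have h₂ := one_le_maxIndex μ
    exact Finset.mem_image.mpr ⟨⟨maxIndex μ - 1, by omega⟩,
      Finset.mem_Iic.mpr (Fin.le_def.mpr (by simp; omega)), by simp; omega⟩
  rw [Finset.card_eq_sum_card_fiberwise hmaps, Finset.sum_image (by
    intro a _ b _ hab; exact Fin.ext (by simpa using hab))]
  refine Finset.sum_congr rfl fun j hj => ?_
  rw [betaVector, ← Set.ncard_coe_finset]
  congr 1
  ext μ
  have hj' : (j : ℕ) ≤ i := Fin.le_def.mp (Finset.mem_Iic.mp hj)
  simp only [Finset.coe_filter, mem_leadingIn, mem_initialSlice, Set.mem_ofPred_eq,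
    monomial_mem_leadingIdeal_iff]
  constructor
  · rintro ⟨⟨⟨h₁, _⟩, h₂⟩, h₃⟩
    exact ⟨h₁, h₂, h₃⟩
  · rintro ⟨h₁, h₂, h₃⟩
    exact ⟨⟨⟨h₁, by omega⟩, h₂⟩, h₃⟩

/-- At the first index where `b` falls below `a`, all earlier entries agreeing, the partial sum of
`b` would be the smaller one. -/
theorem toLex_le_of_partial_sums_le {a b : Fin n → ℕ}
    (h : ∀ i, ∑ j ∈ Finset.Iic i, a j ≤ ∑ j ∈ Finset.Iic i, b j) : toLex a ≤ toLex b := by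
  by_contra hlt
  obtain ⟨i, hi, hi'⟩ := not_le.mp hlt
  refine absurd (h i) (not_le.mpr (Finset.sum_lt_sum (fun j hj => ?_) ⟨i, by simp, hi'⟩))
  rcases (Finset.mem_Iic.mp hj).lt_or_eq with hj | rfl
  · exact (hi j hj).le
  · exact hi'.le

theorem betaVector_congr {J K : Ideal (MvPolynomial (Fin n) k)}
    (h : leadingIdeal J = leadingIdeal K) (q : ℕ) : betaVector J q = betaVector K q := by
  funext i
  simp only [betaVector, h]

theorem betaVector_transform_le_gin [Infinite k] {I : Ideal (MvPolynomial (Fin n) k)}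
    (hI : I.IsHomogeneous (homogeneousSubmodule (Fin n) k)) (B : GL (Fin n) k) (q : ℕ) :
    toLex (betaVector (transform B I) q) ≤ toLex (betaVector (gin I) q) := by
  obtain ⟨-, A, hA, hmax⟩ := gin_spec hI
  have hlt : leadingIdeal (gin I) = leadingIdeal (transform A I) := by
    rw [hA, leadingIdeal_leadingIdeal]
  rw [betaVector_congr hlt]
  refine toLex_le_of_partial_sums_le fun i => ?_
  rw [← card_leadingIn_initialSlice, ← card_leadingIn_initialSlice]
  exact hmax B q _ (isUpperSlice_initialSlice q i)

end Beta

end GenericPosition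

open GenericPosition in
theorem mainTheorem5 {n : ℕ} {k : Type*} [Field k] [Infinite k]
    (I : Ideal (MvPolynomial (Fin n) k))
    (hI : I.IsHomogeneous (MvPolynomial.homogeneousSubmodule (Fin n) k)) :
    (∃! J, IsGenericInitialIdeal I J) ∧
    (InGINPosition I → InBetaMaximalPosition I) ∧
    (InBetaMaximalPosition I →
      ∀ q : ℕ, degreePart I q ≠ ⊥ → betaVector (gin I) q = betaVector I q) := by
  obtain ⟨hgin, A, hA, -⟩ := gin_spec hI
  refine ⟨⟨gin I, hgin, fun J hJ => hJ.unique hgin⟩, fun hpos B q _ => ?_, fun hmax q hq => ?_⟩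
  · have hlt : leadingIdeal I = leadingIdeal (gin I) := by
      rw [← show leadingIdeal I = gin I from hpos, leadingIdeal_leadingIdeal]
    rw [betaVector_congr hlt]
    exact betaVector_transform_le_gin hI B q
  · have hlt : leadingIdeal (gin I) = leadingIdeal (transform A I) := by
      rw [hA, leadingIdeal_leadingIdeal]
    refine toLex.injective (le_antisymm ?_ ?_)
    · rw [betaVector_congr hlt]
      exact hmax A q hq
    -- The identity matrix recovers `I` itself.
    · simpa only [transform_one] using betaVector_transform_le_gin hI 1 q
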